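/- **Setting.** Let $(\Omega,\mathcal F,P)$ be a probability space and let $x_1,x_2,\dots\colon\Omega\to(0,1)$ be i.i.d. random variables. Write $X_n=\{x_1,\dots,x_n\}$ (a multiset) and $X$ for an arbitrary finite nonempty multiset of points of $(0,1)$. Fix $\alpha\in(0,1)$ and $x\in(0,1)$. Assume that the law of $x_1$ is absolutely continuous with respect to Lebesgue measure on $(0,1)$ and let $f$ be a version of its density, positive almost everywhere on $(0,1)$ and extended by $0$ to $\mathbb R$. For $h\in(0,1)$ put $$\hat F_x(X,h)=\frac1{|X|}\#\{y\in X: x-h\le y\le x+h\},\qquad \hat F_x(X,h^-)=\frac1{|X|}\#\{y\in X: x-h< y< x+h\}$$ (counted with multiplicity). A number $h\in(0,1)$ is called a value of the bandwidth $\hat h_{\alpha,x}(X)$ if $\hat F_x(X,h^-)\le\alpha\le\hat F_x(X,h)$. For $J\in\mathbb N$ put $$\mathsf 1_J(t,\theta)=\frac12-\frac2\pi\sum_{j=1}^J\frac{\sin((2j-1)(t-\theta))}{2j-1},\qquad \hat F_{J,x}(X,h)=\frac1{|X|}\sum_{y\in X}\bigl(\mathsf 1_J(y,x+h)-\mathsf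 1_J(y,x-h)\bigr).$$ A number $h\in(0,1)$ with $\hat F_{J,x}(X,h)=\alpha$ is called a value of $\hat h_{J,\alpha,x}(X)$. A statistic $T$ on finite nonempty multisets with values in some $\mathbb R^d$ is *strongly embarrassingly parallel* (SEP) if for every partition of a finite index set $I$ into nonempty blocks $I_1,\dots,I_R$ there is a function $F$, symmetric in its $R$ arguments and depending only on the partition, such that $T(\{y_i\}_{i\in I})=F\bigl(T(\{y_i\}_{i\in I_1}),\dots,T(\{y_i\}_{i\in I_R})\bigr)$ for all data $(y_i)_{i\in I}$. A statistic is *weakly embarrassingly parallel* (WEP) if it is a function of finitely many SEP statistics. **Theorem.** 1. Almost surely, $\hat h_{\alpha,x}(X_n)$ exists for every $n\ge1$. 2. Let $J\in\mathbb N$. Every statistic $T$, defined for those $X$ for which the equation $\hat F_{J,x}(X,h)=\alpha$ has a solution $h\in(0,1)$, and such that $T(X)$ is such a solution, is a WEP statistic. Moreover, the vector of the $2J+1$ numbers $|X|$, $\sum_{y\in X}\cos((2j-1)y)$, $\sum_{y\in X}\sin((2j-1)y)$ $(1\le j\le J)$ is an SEP statistic, and $T$ is a function of it whenever $T(X)$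 depends on $X$ only through the function $h\mapsto\hat F_{J,x}(X,h)$ on $(0,1)$. 3. Assume in addition that, as $J\to\infty$, the functions $$\eta_{J,x}(h)=E\left[\frac1\pi\left(\frac{\sin(2J(x_1-x+h))}{\sin(x_1-x+h)}+\frac{\sin(2J(x_1-x-h))}{\sin(x_1-x-h)}\right)\right]$$ converge to $f(x-h)+f(x+h)$ uniformly in $h\in(0,1)$. Then: (a) almost surely, $\hat F_{J,x}(X_n,h)=\alpha$ has a solution $h\in(0,1)$ whenever $n$ and $J$ are both sufficiently large; (b) there is $h^*\in(0,1)$ with $P(x-h^*\le x_1\le x+h^*)=\alpha$ such that almost surely, for every choice of the values $\hat h_{\alpha,x}(X_n)$ and, whenever they exist, of the values $\hat h_{J,\alpha,x}(X_n)$, $$\lim_{J\to\infty}\limsup_{n\to\infty}\hat h_{J,\alpha,x}(X_n)=\lim_{J\to\infty}\liminf_{n\to\infty}\hat h_{J,\alpha,x}(X_n)=h^*=\lim_{n\to\infty}\hat h_{\alpha,x}(X_n).$$ -/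

import Mathlib

open MeasureTheory ProbabilityTheory Filter Topology

noncomputable section

namespace LocalRegression

/-! ### Embarrassingly parallel statistics

A data set over `𝕏` is a finite nonempty multiset of elements of `𝕏`.  Statistics are functions on
`Multiset 𝕏`; their value at the empty multiset plays no role. -/

/-- A `d`-dimensional statistic `T` is strongly embarrassingly parallel: for every finite index set
and every partition `π` of it into nonempty blocks there is a function `F`, depending on the
partition but not on the data and symmetric in its arguments, that computes the value of `T` on
any data indexed by that set from the values of `T` on the blocks of the data. -/
def IsSEP {𝕏 : Type*} {d : ℕ} (T : Multiset 𝕏 → (Fin d → ℝ)) : Prop :=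
  ∀ (n : ℕ) (π : Finpartition (Finset.univ : Finset (Fin n))),
    ∃ F : (π.parts → (Fin d → ℝ)) → (Fin d → ℝ),
      (∀ (σ : Equiv.Perm π.parts) (v : π.parts → (Fin d → ℝ)), F (v ∘ σ) = F v) ∧
      ∀ x : Fin n → 𝕏,
        T ((Finset.univ : Finset (Fin n)).val.map x) =
          F (fun B => T ((B : Finset (Fin n)).val.map x))

/-- A statistic `T`, defined for the data sets in `D`, is weakly embarrassingly parallel: it is a
function of finitely many (finite-dimensional) strongly embarrassingly parallel statistics. -/
def IsWEPOn {𝕏 : Type*} {β : Type*} (D : Set (Multiset 𝕏)) (T : Multiset 𝕏 → β) : Prop :=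
  ∃ (L : ℕ) (d : Fin L → ℕ) (S : ∀ l : Fin L, Multiset 𝕏 → (Fin (d l) → ℝ)),
    (∀ l, IsSEP (S l)) ∧
      ∃ G : (∀ l : Fin L, Fin (d l) → ℝ) → β, ∀ X ∈ D, T X = G (fun l => S l X)

/-! ### Exact neighbourhood bandwidths -/

/-- The fraction of the data in the closed interval `[x - h, x + h]`. -/
def empirical (x : ℝ) (X : Multiset (Set.Ioo (0 : ℝ) 1)) (h : ℝ) : ℝ :=
  (X.map fun y => (Set.Icc (x - h) (x + h)).indicator (fun _ => (1 : ℝ)) (y : ℝ)).sum / X.card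

/-- The fraction of the data in the open interval `(x - h, x + h)`. -/
def empiricalLeft (x : ℝ) (X : Multiset (Set.Ioo (0 : ℝ) 1)) (h : ℝ) : ℝ :=
  (X.map fun y => (Set.Ioo (x - h) (x + h)).indicator (fun _ => (1 : ℝ)) (y : ℝ)).sum / X.card

/-- The set of all values of the `α`-nearest-neighbour bandwidth at `x`. -/
def exactBandwidths (α x : ℝ) (X : Multiset (Set.Ioo (0 : ℝ) 1)) : Set ℝ :=
  {h | h ∈ Set.Ioo (0 : ℝ) 1 ∧ empiricalLeft x X h ≤ α ∧ α ≤ empirical x X h}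

/-! ### Fourier approximation -/

/-- The `J`-term Fourier approximation to the indicator of `t ≤ θ`. -/
def fourierLE (J : ℕ) (t θ : ℝ) : ℝ :=
  1 / 2 - 2 / Real.pi *
    ∑ j ∈ Finset.Icc 1 J, Real.sin ((2 * (j : ℝ) - 1) * (t - θ)) / (2 * (j : ℝ) - 1)

/-- The `J`-term Fourier approximation to the indicator of `x - h ≤ t ≤ x + h`. -/
def fourierInterval (J : ℕ) (x t h : ℝ) : ℝ :=
  fourierLE J t (x + h) - fourierLE J t (x - h)

/-- The Fourier approximation to `empirical x X h`. -/
def fourierEmpirical (J : ℕ) (x : ℝ) (X : Multiset (Set.Ioo (0 : ℝ) 1)) (h : ℝ) : ℝ :=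
  (X.map fun y => fourierInterval J x (y : ℝ) h).sum / X.card

/-- The solutions `h ∈ (0,1)` of the Fourier-approximated bandwidth equation. -/
def fourierBandwidths (J : ℕ) (α x : ℝ) (X : Multiset (Set.Ioo (0 : ℝ) 1)) : Set ℝ :=
  {h | h ∈ Set.Ioo (0 : ℝ) 1 ∧ fourierEmpirical J x X h = α}

/-- `trig 0 = 1`, `trig (2j-1) t = cos ((2j-1) t)` and `trig (2j) t = sin ((2j-1) t)` for `j ≥ 1`. -/
def trig (k : ℕ) (t : ℝ) : ℝ :=
  if k = 0 then 1
  else if Odd k then Real.cos ((k : ℝ) * t)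
  else Real.sin (((k : ℝ) - 1) * t)

/-- The `2J+1` statistics `|X|`, `∑ᵢ cos ((2j-1) xᵢ)`, `∑ᵢ sin ((2j-1) xᵢ)` for `1 ≤ j ≤ J`. -/
def trigSums (J : ℕ) (X : Multiset (Set.Ioo (0 : ℝ) 1)) : Fin (2 * J + 1) → ℝ :=
  fun k => (X.map fun y => trig (k : ℕ) (y : ℝ)).sum

/-- The derivative in `h` of the expectation of `fourierInterval J x t h`, where `t` has law `μ`,
in closed form.  Only laws without atoms matter, so the points where a sine vanishes are
negligible. -/
def fourierDensity (μ : Measure ℝ) (J : ℕ) (x h : ℝ) : ℝ :=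
  ∫ t, 1 / Real.pi *
    (Real.sin (2 * (J : ℝ) * (t - x + h)) / Real.sin (t - x + h) +
      Real.sin (2 * (J : ℝ) * (t - x - h)) / Real.sin (t - x - h)) ∂μ

/-! ### The sampling model -/

/-- `f` is a version of the density of `μ` with respect to Lebesgue measure on `(0,1)`, extended by
zero to `ℝ`, and it is almost everywhere positive on `(0,1)`. -/
structure IsPositiveDensity (μ : Measure ℝ) (f : ℝ → ℝ) : Prop where
  measurable : Measurable f
  nonneg : ∀ t, 0 ≤ f t
  eq_zero : ∀ t, t ∉ Set.Ioo (0 : ℝ) 1 → f t = 0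
  ae_pos : ∀ᵐ t ∂(volume.restrict (Set.Ioo (0 : ℝ) 1)), 0 < f t
  eq_withDensity : μ = volume.withDensity fun t => ENNReal.ofReal (f t)

/-- The data set formed by the first `n` observations for the outcome `ω`. -/
def sample {Ω : Type*} (ξ : ℕ → Ω → Set.Ioo (0 : ℝ) 1) (n : ℕ) (ω : Ω) :
    Multiset (Set.Ioo (0 : ℝ) 1) :=
  (Multiset.range n).map fun i => ξ i ω

end LocalRegression

end

open LocalRegression

/-!
Data enter only through sums over the sample, and two facts about such sums carry the argument.

**Parallel computation.** A statistic that sums a function over the data is strongly embarrassingly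
parallel (`isSEP_sum_map`); this covers `trigSums J`. The addition theorem for the sine expresses
`fourierEmpirical J x X` through `trigSums J X` (`fourierEmpirical_eq_of_trigSums_eq`), so a
statistic determined by the former factors through the latter. A solution of the approximate
equation may be selected by an arbitrary rule, so in general it is not determined by
`fourierEmpirical`. It is still a function of a single additive statistic: if `φ` maps `(0,1)`
injectively into a basis of `ℝ` over `ℚ`, the sum of `φ` over a multiset determines the multiset
(`exists_injective_sum_map`).

**Consistency.** Let `G` be the distribution function of the observations. It is continuous, and
strictly increasing on `[0,1]` because the density is positive. By the strong law at rational points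
and monotonicity, the empirical distribution functions converge to `G` locally uniformly, almost
surely; everything else is deterministic along a sequence of data sets with this property.

The Fourier approximation `fourierLE J t θ` of `1_{t ≤ θ}` is an affine function of the partial sum
`squareSum J (t - θ)` of a square wave, and `t - θ` stays in `[-2, 2]`, inside one period. These
partial sums differ from their values at `π / 2`, the partial sums of Leibniz' series, by at most
`1 / (2 J sin u)` (`abs_squareSum_sub_le`); hence they are uniformly bounded and converge uniformly
away from the jump. Observations near `θ` are few, by the continuity of `G` and the uniform
convergence of the empirical distribution functions, so `fourierEmpirical J x X h` converges to
`G (x + h) - G (x - h)` uniformly in `h` and jointly in `J` and the sample size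
(`IsUnitCDF.eventually_abs_fourierEmpirical_sub_le`). This limit is continuous in `h`, runs from `0`
to `1`, and increases strictly until it reaches `1`, so it takes the value `α` at exactly one point
and crosses it there. The intermediate value theorem then yields solutions of the approximate
equation, and all solutions, exact or approximate, are forced to converge to that point.
-/

namespace LocalRegression

/-! ### Sums over a data set -/

/-- The statistics unfold to sums over the multiset of real numbers obtained by coercing the data
with the monad structure of `Multiset`; this rewrites them as sums over the data itself. -/
theorem map_coe {β : Type*} (g : ℝ → β) (X : Multiset (Set.Ioo (0 : ℝ) 1)) :
    (Multiset.map g do let a ← X; pure (a : ℝ)) = X.map fun y : Set.Ioo (0 : ℝ) 1 => g y := by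
  simp only [Multiset.bind_def, Multiset.pure_def, Multiset.bind_singleton, Multiset.map_map,
    Function.comp_def]

theorem trigSums_apply (J : ℕ) (X : Multiset (Set.Ioo (0 : ℝ) 1)) (k : Fin (2 * J + 1)) :
    trigSums J X k = (X.map fun y : Set.Ioo (0 : ℝ) 1 => trig k (y : ℝ)).sum := by
  rw [← map_coe (trig k)]
  rfl

theorem empirical_eq (x : ℝ) (X : Multiset (Set.Ioo (0 : ℝ) 1)) (h : ℝ) :
    empirical x X h = (X.map fun y : Set.Ioo (0 : ℝ) 1 =>
      (Set.Icc (x - h) (x + h)).indicator (fun _ => (1 : ℝ)) (y : ℝ)).sum / X.card := by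
  rw [← map_coe]
  rfl

theorem empiricalLeft_eq (x : ℝ) (X : Multiset (Set.Ioo (0 : ℝ) 1)) (h : ℝ) :
    empiricalLeft x X h = (X.map fun y : Set.Ioo (0 : ℝ) 1 =>
      (Set.Ioo (x - h) (x + h)).indicator (fun _ => (1 : ℝ)) (y : ℝ)).sum / X.card := by
  rw [← map_coe]
  rfl

theorem fourierEmpirical_eq (J : ℕ) (x : ℝ) (X : Multiset (Set.Ioo (0 : ℝ) 1)) (h : ℝ) :
    fourierEmpirical J x X h =
      (X.map fun y : Set.Ioo (0 : ℝ) 1 => fourierInterval J x y h).sum / X.card := by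
  rw [← map_coe fun y => fourierInterval J x y h]
  rfl

/-! ### Additive statistics -/

/-- A statistic that sums a vector-valued function over the data is strongly embarrassingly
parallel: its value on the whole data set is the sum of its values on the blocks. -/
theorem isSEP_sum_map {𝕏 : Type*} {d : ℕ} (φ : 𝕏 → Fin d → ℝ) :
    IsSEP fun X : Multiset 𝕏 => (X.map φ).sum := by
  intro n π
  refine ⟨fun v => ∑ B, v B, fun σ v => Equiv.sum_comp σ v, fun x => ?_⟩
  simp only [Multiset.map_map]
  change ∑ i, φ (x i) = ∑ B : π.parts, ∑ i ∈ (B : Finset (Fin n)), φ (x i)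
  rw [Finset.sum_coe_sort π.parts fun B => ∑ i ∈ B, φ (x i)]
  conv_lhs => rw [← π.biUnion_parts]
  exact Finset.sum_biUnion π.supIndep.pairwiseDisjoint

theorem isSEP_trigSums (J : ℕ) : IsSEP (trigSums J) := by
  have h : trigSums J = fun X : Multiset (Set.Ioo (0 : ℝ) 1) =>
      (X.map fun (y : Set.Ioo (0 : ℝ) 1) (k : Fin (2 * J + 1)) => trig k y).sum := by
    funext X k
    induction X using Multiset.induction_on with
    | empty => simp [trigSums_apply]
    | cons a X ih => simpa [trigSums_apply] using ih
  exact h ▸ isSEP_sum_map _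

/-- There is a real function on `(0,1)` whose sum over a multiset determines the multiset, namely
an injection of `(0,1)` into a basis of `ℝ` over `ℚ`: the coordinates of the sum are the
multiplicities. -/
theorem exists_injective_sum_map :
    ∃ φ : Set.Ioo (0 : ℝ) 1 → ℝ,
      Function.Injective fun X : Multiset (Set.Ioo (0 : ℝ) 1) => (X.map φ).sum := by
  classical
  let b := Module.Basis.ofVectorSpace ℚ ℝ
  obtain ⟨e⟩ : Nonempty (Set.Ioo (0 : ℝ) 1 ≃ Module.Basis.ofVectorSpaceIndex ℚ ℝ) := by
    rw [← Cardinal.eq, b.mk_eq_rank'', Real.rank_rat_real]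
    exact Cardinal.mk_Ioo_real one_pos
  have key : ∀ (y) (X : Multiset (Set.Ioo (0 : ℝ) 1)),
      b.coord (e y) (X.map fun z => b (e z)).sum = X.count y := by
    intro y X
    induction X using Multiset.induction_on with
    | empty => simp
    | cons a X ih =>
      rw [Multiset.map_cons, Multiset.sum_cons, map_add, ih, Multiset.count_cons]
      simp [Finsupp.single_apply, add_comm, eq_comm]
  refine ⟨fun z => b (e z), fun X Y h => Multiset.ext.2 fun y => ?_⟩
  have := congrArg (b.coord (e y)) h
  simpa only [key, Nat.cast_inj] using this

/-- On data in `(0,1)` every statistic is a function of one additive real statistic, hence weakly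
embarrassingly parallel. -/
theorem isWEPOn_of_Ioo {β : Type*} (D : Set (Multiset (Set.Ioo (0 : ℝ) 1)))
    (T : Multiset (Set.Ioo (0 : ℝ) 1) → β) : IsWEPOn D T := by
  obtain ⟨φ, hφ⟩ := exists_injective_sum_map
  have hinj : Function.Injective
      fun (X : Multiset (Set.Ioo (0 : ℝ) 1)) (_ : Fin 1) =>
        (X.map fun y (_ : Fin 1) => φ y).sum := by
    intro X Y h
    have hX : ∀ X : Multiset (Set.Ioo (0 : ℝ) 1),
        (X.map fun y (_ : Fin 1) => φ y).sum 0 = (X.map φ).sum := by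
      intro X
      induction X using Multiset.induction_on with
      | empty => simp
      | cons a X ih => simpa using ih
    exact hφ (by simpa only [hX] using congrFun (congrFun h 0) 0)
  have : Nonempty β := ⟨T 0⟩
  obtain ⟨G, hG⟩ := (Function.factorsThrough_iff T).1 (hinj.factorsThrough T)
  exact ⟨1, fun _ => 1, fun _ X => (X.map fun y (_ : Fin 1) => φ y).sum,
    fun _ => isSEP_sum_map _, G, fun X _ => congrFun hG X⟩

/-! ### The trigonometric sums determine the approximate empirical function -/

theorem trig_two_mul_sub_one {j : ℕ} (hj : 1 ≤ j) (t : ℝ) :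
    trig (2 * j - 1) t = Real.cos ((2 * j - 1) * t) := by
  have h : Odd (2 * j - 1) := ⟨j - 1, by omega⟩
  rw [trig, if_neg (by omega), if_pos h, Nat.cast_sub (by omega)]
  push_cast
  rfl

theorem trig_two_mul {j : ℕ} (hj : 1 ≤ j) (t : ℝ) :
    trig (2 * j) t = Real.sin ((2 * j - 1) * t) := by
  rw [trig, if_neg (by omega), if_neg (by simp)]
  push_cast
  rfl

theorem fourierLE_eq_trig (J : ℕ) (t θ : ℝ) :
    fourierLE J t θ = 1 / 2 * trig 0 t - 2 / Real.pi * ∑ j ∈ Finset.Icc 1 J,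
      (Real.cos ((2 * j - 1) * θ) / (2 * j - 1) * trig (2 * j) t -
        Real.sin ((2 * j - 1) * θ) / (2 * j - 1) * trig (2 * j - 1) t) := by
  have h0 : trig 0 t = 1 := if_pos rfl
  rw [fourierLE, h0, mul_one]
  congr 2
  refine Finset.sum_congr rfl fun j hj => ?_
  have hj := (Finset.mem_Icc.1 hj).1
  rw [trig_two_mul hj, trig_two_mul_sub_one hj, mul_sub, Real.sin_sub]
  ring

theorem sum_map_fourierLE_eq_of_trigSums_eq {J : ℕ} {X Y : Multiset (Set.Ioo (0 : ℝ) 1)}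
    (h : trigSums J X = trigSums J Y) (θ : ℝ) :
    (X.map fun y : Set.Ioo (0 : ℝ) 1 => fourierLE J y θ).sum =
      (Y.map fun y : Set.Ioo (0 : ℝ) 1 => fourierLE J y θ).sum := by
  have hk : ∀ k < 2 * J + 1,
      (X.map fun y : Set.Ioo (0 : ℝ) 1 => trig k y).sum =
        (Y.map fun y : Set.Ioo (0 : ℝ) 1 => trig k y).sum := fun k hk => by
    simpa only [trigSums_apply] using congrFun h ⟨k, hk⟩
  have expand : ∀ Z : Multiset (Set.Ioo (0 : ℝ) 1),
      (Z.map fun y : Set.Ioo (0 : ℝ) 1 => fourierLE J (y : ℝ) θ).sum =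
        1 / 2 * (Z.map fun y : Set.Ioo (0 : ℝ) 1 => trig 0 y).sum -
          2 / Real.pi * ∑ j ∈ Finset.Icc 1 J,
            (Real.cos ((2 * j - 1) * θ) / (2 * j - 1) *
                (Z.map fun y : Set.Ioo (0 : ℝ) 1 => trig (2 * j) y).sum -
              Real.sin ((2 * j - 1) * θ) / (2 * j - 1) *
                (Z.map fun y : Set.Ioo (0 : ℝ) 1 => trig (2 * j - 1) y).sum) := by
    intro Z
    induction Z using Multiset.induction_on with
    | empty => simp
    | cons a Z ih =>
      simp only [Multiset.map_cons, Multiset.sum_cons, ih, fourierLE_eq_trig J a,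
        Finset.sum_sub_distrib, Finset.sum_add_distrib, mul_add]
      ring
  rw [expand, expand, hk 0 (by omega)]
  congr 2
  refine Finset.sum_congr rfl fun j hj => ?_
  have hj := Finset.mem_Icc.1 hj
  rw [hk (2 * j) (by omega), hk (2 * j - 1) (by omega)]

theorem fourierEmpirical_eq_sub (J : ℕ) (x : ℝ) (X : Multiset (Set.Ioo (0 : ℝ) 1)) (h : ℝ) :
    fourierEmpirical J x X h =
      (X.map fun y : Set.Ioo (0 : ℝ) 1 => fourierLE J (y : ℝ) (x + h)).sum / X.card -
        (X.map fun y : Set.Ioo (0 : ℝ) 1 => fourierLE J (y : ℝ) (x - h)).sum / X.card := by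
  simp only [fourierEmpirical_eq, fourierInterval, Multiset.sum_map_sub, sub_div]

theorem fourierEmpirical_eq_of_trigSums_eq {J : ℕ} {X Y : Multiset (Set.Ioo (0 : ℝ) 1)}
    (h : trigSums J X = trigSums J Y) (x : ℝ) :
    fourierEmpirical J x X = fourierEmpirical J x Y := by
  have hcard : (X.card : ℝ) = Y.card := by
    have := congrFun h ⟨0, by omega⟩
    simpa [trigSums_apply, trig] using this
  funext s
  rw [fourierEmpirical_eq_sub, fourierEmpirical_eq_sub, sum_map_fourierLE_eq_of_trigSums_eq h,
    sum_map_fourierLE_eq_of_trigSums_eq h, hcard]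

/-- A statistic determined on `D` by the function `h ↦ fourierEmpirical J x X h` on `(0,1)` is a
function of `trigSums J`. -/
theorem exists_eq_comp_trigSums {J : ℕ} {x : ℝ} {D : Set (Multiset (Set.Ioo (0 : ℝ) 1))}
    {T : Multiset (Set.Ioo (0 : ℝ) 1) → ℝ}
    (hT : ∀ X ∈ D, ∀ X' ∈ D,
      Set.EqOn (fourierEmpirical J x X) (fourierEmpirical J x X') (Set.Ioo (0 : ℝ) 1) →
        T X = T X') :
    ∃ G : (Fin (2 * J + 1) → ℝ) → ℝ, ∀ X ∈ D, T X = G (trigSums J X) := by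
  have : Function.FactorsThrough (fun X : D => T X) fun X : D => trigSums J X := fun X Y h =>
    hT X X.2 Y Y.2 fun s _ => congrFun (fourierEmpirical_eq_of_trigSums_eq h x) s
  obtain ⟨G, hG⟩ := (Function.factorsThrough_iff _).1 this
  exact ⟨G, fun X hX => congrFun hG ⟨X, hX⟩⟩

/-! ### The partial sums of the square wave -/

/-- The partial sum `∑_{j ≤ J} sin ((2j-1)u) / (2j-1)` of the Fourier series of the square wave
`(π / 4) sign u` on `(-π, π)`. -/
noncomputable def squareSum (J : ℕ) (u : ℝ) : ℝ :=
  ∑ j ∈ Finset.Icc 1 J, Real.sin ((2 * (j : ℝ) - 1) * u) / (2 * (j : ℝ) - 1)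

theorem fourierLE_eq_squareSum (J : ℕ) (t θ : ℝ) :
    fourierLE J t θ = 1 / 2 - 2 / Real.pi * squareSum J (t - θ) := rfl

theorem one_le_two_mul_sub_one {J j : ℕ} (hj : j ∈ Finset.Icc 1 J) : 1 ≤ 2 * (j : ℝ) - 1 := by
  have : (1 : ℝ) ≤ j := by exact_mod_cast (Finset.mem_Icc.1 hj).1
  linarith

theorem squareSum_neg (J : ℕ) (u : ℝ) : squareSum J (-u) = -squareSum J u := by
  simp [squareSum, neg_div]

theorem squareSum_pi_sub (J : ℕ) (u : ℝ) : squareSum J (Real.pi - u) = squareSum J u := by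
  refine Finset.sum_congr rfl fun j _ => ?_
  have h : (2 * (j : ℝ) - 1) * (Real.pi - u) =
      (Real.pi - (2 * (j : ℝ) - 1) * u) + ((j : ℤ) - 1 : ℤ) * (2 * Real.pi) := by
    push_cast
    ring
  rw [h, Real.sin_add_int_mul_two_pi, Real.sin_pi_sub]

theorem sin_mul_sum_cos (J : ℕ) (u : ℝ) :
    Real.sin u * ∑ j ∈ Finset.Icc 1 J, Real.cos ((2 * (j : ℝ) - 1) * u) =
      Real.sin (2 * J * u) / 2 := by
  induction J with
  | zero => simp
  | succ J ih =>
    rw [Finset.sum_Icc_succ_top (by omega), mul_add, ih]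
    have h1 : 2 * (J : ℝ) * u = (2 * ((J + 1 : ℕ) : ℝ) - 1) * u - u := by push_cast; ring
    have h2 : 2 * ((J + 1 : ℕ) : ℝ) * u = (2 * ((J + 1 : ℕ) : ℝ) - 1) * u + u := by ring
    rw [h1, h2, Real.sin_sub, Real.sin_add]
    ring

theorem hasDerivAt_squareSum (J : ℕ) {u : ℝ} (hu : Real.sin u ≠ 0) :
    HasDerivAt (squareSum J) (Real.sin (2 * J * u) / (2 * Real.sin u)) u := by
  have h : Real.sin (2 * J * u) / (2 * Real.sin u) =
      ∑ j ∈ Finset.Icc 1 J, Real.cos ((2 * (j : ℝ) - 1) * u) := by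
    rw [div_eq_iff (by simpa using hu)]
    linarith [sin_mul_sum_cos J u]
  rw [h]
  refine HasDerivAt.fun_sum fun j hj => ?_
  have hj : 2 * (j : ℝ) - 1 ≠ 0 := by linarith [one_le_two_mul_sub_one hj]
  have := ((hasDerivAt_id u).const_mul (2 * (j : ℝ) - 1)).sin.div_const (2 * (j : ℝ) - 1)
  simpa [hj] using this

/-- The derivative of `squareSum J u` oscillates with frequency `2J`; adding the term
`cos (2Ju) / (4J sin u)` of an integration by parts leaves a derivative that `± 1 / (4J sin u)`
dominates. -/
theorem hasDerivAt_squareSum_add {J : ℕ} (hJ : 1 ≤ J) (c : ℝ) {u : ℝ} (hu : Real.sin u ≠ 0) :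
    HasDerivAt (fun u => squareSum J u + (Real.cos (2 * J * u) + c) / (4 * J * Real.sin u))
      (-((Real.cos (2 * J * u) + c) * Real.cos u / (4 * J * Real.sin u ^ 2))) u := by
  have hJ : (J : ℝ) ≠ 0 := by exact_mod_cast (by omega : J ≠ 0)
  have h := (hasDerivAt_squareSum J hu).add
    (((((hasDerivAt_id u).const_mul (2 * (J : ℝ))).cos.add_const c).div
      ((Real.hasDerivAt_sin u).const_mul (4 * (J : ℝ))) (by positivity)))
  refine h.congr_deriv ?_
  simp only [id]
  field_simp
  ring

theorem sin_pos_of_mem_Icc {u v : ℝ} (hu : 0 < u) (hv : v ∈ Set.Icc u (Real.pi / 2)) :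
    0 < Real.sin v :=
  Real.sin_pos_of_pos_of_lt_pi (hu.trans_le hv.1) (by linarith [hv.2, Real.pi_pos])

theorem abs_squareSum_sub_le_of_le_pi_div_two {J : ℕ} (hJ : 1 ≤ J) {u : ℝ} (hu : 0 < u)
    (hu2 : u ≤ Real.pi / 2) :
    |squareSum J u - squareSum J (Real.pi / 2)| ≤ 1 / (2 * J * Real.sin u) := by
  have hJ0 : (0 : ℝ) < J := by exact_mod_cast hJ
  have hsin : ∀ v ∈ Set.Icc u (Real.pi / 2), 0 < Real.sin v := fun v => sin_pos_of_mem_Icc hu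
  have hcos : ∀ v ∈ Set.Icc u (Real.pi / 2), 0 ≤ Real.cos v := fun v hv =>
    Real.cos_nonneg_of_mem_Icc ⟨by linarith [hv.1, Real.pi_pos], hv.2⟩
  have hcont : ∀ c, ContinuousOn
      (fun u => squareSum J u + (Real.cos (2 * J * u) + c) / (4 * J * Real.sin u))
      (Set.Icc u (Real.pi / 2)) := fun c v hv =>
    (hasDerivAt_squareSum_add hJ c (hsin v hv).ne').continuousAt.continuousWithinAt
  have hderiv : ∀ c, ∀ v ∈ interior (Set.Icc u (Real.pi / 2)), HasDerivWithinAt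
      (fun u => squareSum J u + (Real.cos (2 * J * u) + c) / (4 * J * Real.sin u))
      (-((Real.cos (2 * J * v) + c) * Real.cos v / (4 * J * Real.sin v ^ 2)))
      (interior (Set.Icc u (Real.pi / 2))) v := fun c v hv =>
    (hasDerivAt_squareSum_add hJ c (hsin v (interior_subset hv)).ne').hasDerivWithinAt
  have h1 := antitoneOn_of_hasDerivWithinAt_nonpos (convex_Icc u (Real.pi / 2)) (hcont 1)
    (hderiv 1) (fun v hv => by
      have := hcos v (interior_subset hv)
      have := Real.neg_one_le_cos (2 * J * v)
      have : 0 ≤ Real.cos (2 * J * v) + 1 := by linarith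
      rw [neg_nonpos]
      positivity) (Set.left_mem_Icc.2 hu2) (Set.right_mem_Icc.2 hu2) hu2
  have h2 := monotoneOn_of_hasDerivWithinAt_nonneg (convex_Icc u (Real.pi / 2)) (hcont (-1))
    (hderiv (-1)) (fun v hv => by
      have := hcos v (interior_subset hv)
      have := Real.cos_le_one (2 * J * v)
      rw [neg_nonneg]
      exact div_nonpos_of_nonpos_of_nonneg
        (mul_nonpos_of_nonpos_of_nonneg (by linarith) (by assumption)) (by positivity))
    (Set.left_mem_Icc.2 hu2) (Set.right_mem_Icc.2 hu2) hu2
  have hs := hsin u (Set.left_mem_Icc.2 hu2)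
  have e : 1 / (2 * J * Real.sin u) = 2 / (4 * J * Real.sin u) := by
    field_simp
    norm_num
  simp only [Real.sin_pi_div_two, mul_one] at h1 h2
  have a1 : 0 ≤ (Real.cos (2 * J * (Real.pi / 2)) + 1) / (4 * J) :=
    div_nonneg (by linarith [Real.neg_one_le_cos (2 * J * (Real.pi / 2))]) (by positivity)
  have a2 : (Real.cos (2 * J * (Real.pi / 2)) + -1) / (4 * J) ≤ 0 :=
    div_nonpos_of_nonpos_of_nonneg (by linarith [Real.cos_le_one (2 * J * (Real.pi / 2))])
      (by positivity)
  have b1 : (Real.cos (2 * J * u) + 1) / (4 * J * Real.sin u) ≤ 2 / (4 * J * Real.sin u) := by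
    gcongr
    linarith [Real.cos_le_one (2 * J * u)]
  have b2 : -2 / (4 * J * Real.sin u) ≤ (Real.cos (2 * J * u) + -1) / (4 * J * Real.sin u) := by
    gcongr
    linarith [Real.neg_one_le_cos (2 * J * u)]
  rw [neg_div] at b2
  rw [e, abs_le]
  constructor <;> linarith

theorem abs_squareSum_sub_le {J : ℕ} (hJ : 1 ≤ J) {u : ℝ} (hu : 0 < u) (hu2 : u < Real.pi) :
    |squareSum J u - squareSum J (Real.pi / 2)| ≤ 1 / (2 * J * Real.sin u) := by
  rcases le_total u (Real.pi / 2) with h | h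
  · exact abs_squareSum_sub_le_of_le_pi_div_two hJ hu h
  · rw [← squareSum_pi_sub, ← Real.sin_pi_sub]
    exact abs_squareSum_sub_le_of_le_pi_div_two hJ (by linarith) (by linarith)

/-- At `π / 2` the square wave series is the Leibniz series. -/
theorem tendsto_squareSum_pi_div_two :
    Tendsto (fun J => squareSum J (Real.pi / 2)) atTop (𝓝 (Real.pi / 4)) := by
  refine Real.tendsto_sum_pi_div_four.congr fun J => ?_
  induction J with
  | zero => simp [squareSum]
  | succ J ih =>
    rw [Finset.sum_range_succ, ih, squareSum, squareSum, Finset.sum_Icc_succ_top (by omega)]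
    have h : (2 * ((J + 1 : ℕ) : ℝ) - 1) * (Real.pi / 2) = Real.pi / 2 + J * Real.pi := by
      push_cast
      ring
    rw [h, Real.sin_add_nat_mul_pi, Real.sin_pi_div_two, mul_one]
    push_cast
    ring

theorem sin_le_sin_of_le_two {δ u : ℝ} (hδ : 0 < δ) (hδ1 : δ ≤ 1) (hδu : δ ≤ u) (hu : u ≤ 2) :
    Real.sin δ ≤ Real.sin u := by
  have := Real.pi_gt_three
  rcases le_total u (Real.pi / 2) with h | h
  · exact Real.sin_le_sin_of_le_of_le_pi_div_two (by linarith) h hδu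
  · rw [← Real.sin_pi_sub u]
    exact Real.sin_le_sin_of_le_of_le_pi_div_two (by linarith) (by linarith) (by linarith)

theorem abs_squareSum_le_mul (J : ℕ) {u : ℝ} (hu : 0 ≤ u) : |squareSum J u| ≤ J * u := by
  calc |squareSum J u| ≤ ∑ j ∈ Finset.Icc 1 J, u := by
        refine (Finset.abs_sum_le_sum_abs _ _).trans (Finset.sum_le_sum fun j hj => ?_)
        have h := one_le_two_mul_sub_one hj
        have hp : 0 < 2 * (j : ℝ) - 1 := by linarith
        rw [abs_div, abs_of_pos hp, div_le_iff₀ hp]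
        refine Real.abs_sin_le_abs.trans ?_
        rw [abs_mul, abs_of_pos hp, abs_of_nonneg hu, mul_comm]
    _ = J * u := by simp

/-- The partial sums are uniformly bounded: for `u ≤ 1 / J` term by term, for larger `u` by
comparison with the value at `π / 2`. -/
theorem exists_abs_squareSum_le : ∃ C, ∀ J : ℕ, ∀ u : ℝ, |u| ≤ 2 → |squareSum J u| ≤ C := by
  obtain ⟨C, hC⟩ :=
    (Metric.isBounded_range_of_tendsto _ tendsto_squareSum_pi_div_two).exists_norm_le
  have hC : ∀ J : ℕ, |squareSum J (Real.pi / 2)| ≤ C := fun J => hC _ ⟨J, rfl⟩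
  have hC0 : 0 ≤ C := (abs_nonneg _).trans (hC 0)
  have hpi := Real.pi_pos
  have hpi3 := Real.pi_gt_three
  have key : ∀ J : ℕ, ∀ u : ℝ, 0 ≤ u → u ≤ 2 → |squareSum J u| ≤ C + (1 + Real.pi / 4) := by
    intro J u hu hu2
    by_cases hJu : J * u ≤ 1
    · linarith [abs_squareSum_le_mul J hu]
    push Not at hJu
    have hJ : 1 ≤ J := by
      by_contra h
      obtain rfl : J = 0 := by omega
      norm_num at hJu
    have hJ0 : (0 : ℝ) < J := by exact_mod_cast hJ
    have hJ1 : (1 : ℝ) ≤ J := by exact_mod_cast hJ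
    have hJu' : 1 / (J : ℝ) ≤ u := by
      rw [div_le_iff₀ hJ0]
      linarith
    have hinv : 1 / (J : ℝ) ≤ 1 := by rwa [div_le_one hJ0]
    have hs : 2 / Real.pi * (1 / J) ≤ Real.sin u :=
      (Real.mul_le_sin (by positivity) (by linarith)).trans
        (sin_le_sin_of_le_two (by positivity) hinv hJu' hu2)
    have hb : 1 / (2 * J * Real.sin u) ≤ Real.pi / 4 := by
      have hpos : 0 < 2 * J * (2 / Real.pi * (1 / (J : ℝ))) := by positivity
      calc 1 / (2 * J * Real.sin u) ≤ 1 / (2 * J * (2 / Real.pi * (1 / (J : ℝ)))) := by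
            gcongr
        _ = Real.pi / 4 := by
            field_simp
            norm_num
    have := abs_squareSum_sub_le hJ (u := u) (by by_contra h; nlinarith) (by linarith)
    have h3 := abs_add_le (squareSum J u - squareSum J (Real.pi / 2)) (squareSum J (Real.pi / 2))
    rw [sub_add_cancel] at h3
    linarith [hC J]
  refine ⟨C + (1 + Real.pi / 4), fun J u hu => ?_⟩
  rcases le_total 0 u with h | h
  · exact key J u h (by rwa [abs_of_nonneg h] at hu)
  · rw [← abs_neg, ← squareSum_neg]
    exact key J (-u) (by linarith) (by rwa [abs_of_nonpos h] at hu)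

/-- Away from the jump at `0` the partial sums converge uniformly. -/
theorem eventually_abs_squareSum_sub_le {δ ε : ℝ} (hδ : 0 < δ) (hε : 0 < ε) :
    ∀ᶠ J : ℕ in atTop, ∀ u : ℝ, δ ≤ u → u ≤ 2 → |squareSum J u - Real.pi / 4| ≤ ε := by
  set δ' := min δ 1 with hδ'
  have hδ0 : 0 < δ' := lt_min hδ one_pos
  have hpi := Real.pi_gt_three
  have hs : 0 < Real.sin δ' :=
    Real.sin_pos_of_pos_of_lt_pi hδ0 (by linarith [min_le_right δ 1])
  have h1 : Tendsto (fun J : ℕ => 1 / (2 * J * Real.sin δ')) atTop (𝓝 0) := by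
    have := tendsto_one_div_atTop_nhds_zero_nat (𝕜 := ℝ).mul_const (1 / (2 * Real.sin δ'))
    rw [zero_mul] at this
    refine this.congr fun J => ?_
    rw [div_mul_div_comm]
    congr 1 <;> ring
  have h2 := (tendsto_squareSum_pi_div_two.sub_const (Real.pi / 4)).abs
  rw [sub_self, abs_zero] at h2
  have h3 := h1.add h2
  rw [add_zero] at h3
  filter_upwards [h3.eventually (gt_mem_nhds hε), eventually_ge_atTop 1] with J hJ hJ1 u hu hu2
  have hJ0 : (0 : ℝ) < J := by exact_mod_cast hJ1
  have hu' : δ' ≤ u := (min_le_left _ _).trans hu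
  have hb := abs_squareSum_sub_le hJ1 (u := u) (hδ0.trans_le hu') (by linarith)
  have hc : 1 / (2 * J * Real.sin u) ≤ 1 / (2 * J * Real.sin δ') := by
    gcongr
    exact sin_le_sin_of_le_two hδ0 (min_le_right _ _) hu' hu2
  have := abs_sub_le (squareSum J u) (squareSum J (Real.pi / 2)) (Real.pi / 4)
  linarith

/-! ### The Fourier approximation of a half-line indicator -/

theorem exists_abs_fourierLE_sub_indicator_le :
    ∃ C, 0 ≤ C ∧ ∀ (J : ℕ) (t θ : ℝ), |t - θ| ≤ 2 →
      |fourierLE J t θ - (Set.Iic θ).indicator (fun _ => (1 : ℝ)) t| ≤ C := by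
  obtain ⟨C, hC⟩ := exists_abs_squareSum_le
  have hC0 : 0 ≤ C := (abs_nonneg _).trans (hC 0 0 (by simp))
  have hpi := Real.pi_pos
  refine ⟨1 / 2 + 2 / Real.pi * C + 1, by positivity, fun J t θ h => ?_⟩
  have h1 := hC J _ h
  have h2 : |2 / Real.pi * squareSum J (t - θ)| ≤ 2 / Real.pi * C := by
    rw [abs_mul, abs_of_pos (by positivity)]
    gcongr
  have h3 : (Set.Iic θ).indicator (fun _ => (1 : ℝ)) t ∈ Set.Icc (0 : ℝ) 1 := by
    by_cases ht : t ∈ Set.Iic θ <;> simp [ht]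
  rw [fourierLE_eq_squareSum]
  rw [abs_le] at h2 ⊢
  constructor <;> linarith [h3.1, h3.2]

theorem eventually_abs_fourierLE_sub_indicator_le {δ ε : ℝ} (hδ : 0 < δ) (hε : 0 < ε) :
    ∀ᶠ J : ℕ in atTop, ∀ t θ : ℝ, δ ≤ |t - θ| → |t - θ| ≤ 2 →
      |fourierLE J t θ - (Set.Iic θ).indicator (fun _ => (1 : ℝ)) t| ≤ ε := by
  have hpi := Real.pi_pos
  filter_upwards [eventually_abs_squareSum_sub_le hδ (by positivity : 0 < Real.pi / 2 * ε)]
    with J hJ t θ h1 h2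
  have hb := hJ _ h1 h2
  have hscale : |2 / Real.pi * (squareSum J |t - θ| - Real.pi / 4)| ≤ ε := by
    rw [abs_mul, abs_of_pos (by positivity)]
    calc 2 / Real.pi * _ ≤ 2 / Real.pi * (Real.pi / 2 * ε) := by gcongr
      _ = ε := by field_simp
  have e : 2 / Real.pi * (Real.pi / 4) = 1 / 2 := by
    field_simp
    norm_num
  rw [mul_sub, e] at hscale
  rw [fourierLE_eq_squareSum]
  by_cases ht : t ≤ θ
  · rw [abs_of_nonpos (by linarith : t - θ ≤ 0), squareSum_neg] at hscale
    rw [Set.indicator_of_mem (Set.mem_Iic.2 ht), abs_le]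
    rw [abs_le] at hscale
    constructor <;> linarith
  · rw [abs_of_pos (by linarith : 0 < t - θ)] at hscale
    rw [Set.indicator_of_notMem (by simpa using ht), abs_le]
    rw [abs_le] at hscale
    constructor <;> linarith

theorem continuous_fourierLE (J : ℕ) (t : ℝ) : Continuous (fourierLE J t) := by
  unfold fourierLE
  fun_prop

/-! ### Means over a data set -/

/-- The mean of `g` over the data set `X`, with the value `0` for the empty data set. -/
noncomputable def dataMean (X : Multiset (Set.Ioo (0 : ℝ) 1)) (g : ℝ → ℝ) : ℝ :=
  (X.map fun y : Set.Ioo (0 : ℝ) 1 => g y).sum / X.card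

/-- The empirical distribution function of the data set `X`. -/
noncomputable def empCDF (X : Multiset (Set.Ioo (0 : ℝ) 1)) (t : ℝ) : ℝ :=
  dataMean X ((Set.Iic t).indicator fun _ => 1)

theorem dataMean_sub (X : Multiset (Set.Ioo (0 : ℝ) 1)) (g k : ℝ → ℝ) :
    dataMean X (fun t => g t - k t) = dataMean X g - dataMean X k := by
  simp only [dataMean, Multiset.sum_map_sub, sub_div]

theorem dataMean_add (X : Multiset (Set.Ioo (0 : ℝ) 1)) (g k : ℝ → ℝ) :
    dataMean X (fun t => g t + k t) = dataMean X g + dataMean X k := by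
  simp only [dataMean, Multiset.sum_map_add, add_div]

theorem dataMean_const_mul (X : Multiset (Set.Ioo (0 : ℝ) 1)) (c : ℝ) (g : ℝ → ℝ) :
    dataMean X (fun t => c * g t) = c * dataMean X g := by
  simp only [dataMean, Multiset.sum_map_mul_left, mul_div_assoc]

theorem dataMean_const_le (X : Multiset (Set.Ioo (0 : ℝ) 1)) {c : ℝ} (hc : 0 ≤ c) :
    dataMean X (fun _ => c) ≤ c := by
  simp only [dataMean, Multiset.map_const', Multiset.sum_replicate, nsmul_eq_mul]
  exact div_le_of_le_mul₀ (Nat.cast_nonneg _) hc (by rw [mul_comm])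

theorem dataMean_le_dataMean (X : Multiset (Set.Ioo (0 : ℝ) 1)) {g k : ℝ → ℝ}
    (h : ∀ t ∈ Set.Ioo (0 : ℝ) 1, g t ≤ k t) : dataMean X g ≤ dataMean X k := by
  unfold dataMean
  gcongr ?_ / _
  exact Multiset.sum_map_le_sum_map _ _ fun y _ => h y y.2

theorem abs_dataMean_sub_le (X : Multiset (Set.Ioo (0 : ℝ) 1)) {g k e : ℝ → ℝ}
    (h : ∀ t ∈ Set.Ioo (0 : ℝ) 1, |g t - k t| ≤ e t) :
    |dataMean X g - dataMean X k| ≤ dataMean X e := by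
  rw [abs_sub_le_iff]
  constructor <;> rw [sub_le_iff_le_add, ← dataMean_add] <;>
    refine dataMean_le_dataMean X fun t ht => ?_ <;> have := abs_sub_le_iff.1 (h t ht) <;> linarith

theorem empCDF_monotone (X : Multiset (Set.Ioo (0 : ℝ) 1)) : Monotone (empCDF X) := fun _ _ h =>
  dataMean_le_dataMean X fun t _ =>
    Set.indicator_le_indicator_of_subset (Set.Iic_subset_Iic.2 h) (fun _ => zero_le_one) t

theorem empirical_le {x h h' : ℝ} (h0 : 0 ≤ h) (hh : h < h')
    (X : Multiset (Set.Ioo (0 : ℝ) 1)) :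
    empirical x X h ≤ empCDF X (x + h') - empCDF X (x - h') := by
  rw [empirical_eq, empCDF, empCDF, ← dataMean_sub]
  refine dataMean_le_dataMean X (g := (Set.Icc (x - h) (x + h)).indicator fun _ => (1 : ℝ))
    fun t _ => ?_
  simp only [Set.indicator_apply, Set.mem_Icc, Set.mem_Iic]
  split_ifs <;> grind

theorem le_empiricalLeft {x h h' : ℝ} (hh : h' < h) (X : Multiset (Set.Ioo (0 : ℝ) 1)) :
    empCDF X (x + h') - empCDF X (x - h') ≤ empiricalLeft x X h := by
  rw [empiricalLeft_eq, empCDF, empCDF, ← dataMean_sub]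
  refine dataMean_le_dataMean X (k := (Set.Ioo (x - h) (x + h)).indicator fun _ => (1 : ℝ))
    fun t _ => ?_
  simp only [Set.indicator_apply, Set.mem_Ioo, Set.mem_Iic]
  split_ifs <;> grind

theorem fourierEmpirical_eq_dataMean (J : ℕ) (x : ℝ) (X : Multiset (Set.Ioo (0 : ℝ) 1)) (h : ℝ) :
    fourierEmpirical J x X h =
      dataMean X (fun t => fourierLE J t (x + h)) - dataMean X (fun t => fourierLE J t (x - h)) :=
  fourierEmpirical_eq_sub J x X h

theorem continuous_fourierEmpirical (J : ℕ) (x : ℝ) (X : Multiset (Set.Ioo (0 : ℝ) 1)) :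
    Continuous (fourierEmpirical J x X) := by
  have : fourierEmpirical J x X = fun h =>
      (X.map fun y : Set.Ioo (0 : ℝ) 1 => fourierInterval J x y h).sum / X.card :=
    funext fun h => fourierEmpirical_eq J x X h
  rw [this]
  refine (continuous_multiset_sum X fun y _ => ?_).div_const _
  exact ((continuous_fourierLE J y).comp (by fun_prop)).sub
    ((continuous_fourierLE J y).comp (by fun_prop))

/-! ### Uniform convergence of distribution functions -/

/-- Monotone functions that converge on the rationals to a continuous function converge locally
uniformly. -/
theorem tendstoLocallyUniformly_of_monotone {F : ℕ → ℝ → ℝ} {G : ℝ → ℝ}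
    (hF : ∀ n, Monotone (F n)) (hG : Continuous G)
    (h : ∀ q : ℚ, Tendsto (fun n => F n q) atTop (𝓝 (G q))) :
    TendstoLocallyUniformly F G atTop := by
  rw [Metric.tendstoLocallyUniformly_iff]
  intro ε hε t
  obtain ⟨δ, hδ, hball⟩ := Metric.continuousAt_iff.1 (hG.continuousAt (x := t)) (ε / 4)
    (by positivity)
  obtain ⟨a, ha, ha'⟩ := exists_rat_btwn (sub_lt_self t hδ)
  obtain ⟨b, hb, hb'⟩ := exists_rat_btwn (lt_add_of_pos_right t hδ)
  have hnear : ∀ s ∈ Set.Icc (a : ℝ) b, |G s - G t| < ε / 4 := fun s hs =>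
    hball (by rw [Real.dist_eq, abs_lt]; constructor <;> linarith [hs.1, hs.2])
  refine ⟨Set.Icc a b, Icc_mem_nhds ha' hb, ?_⟩
  filter_upwards [Metric.tendsto_nhds.1 (h a) (ε / 4) (by positivity),
    Metric.tendsto_nhds.1 (h b) (ε / 4) (by positivity)] with n hna hnb s hs
  have hab : (a : ℝ) ≤ b := hs.1.trans hs.2
  have e1 := abs_lt.1 (hnear a ⟨le_rfl, hab⟩)
  have e2 := abs_lt.1 (hnear b ⟨hab, le_rfl⟩)
  have e3 := abs_lt.1 (hnear s hs)
  have e4 := hF n hs.1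
  have e5 := hF n hs.2
  rw [Real.dist_eq, abs_lt] at hna hnb ⊢
  constructor <;> linarith

/-- If the empirical distribution functions of `X n` converge to the continuous function `G`, so do
the means of the Fourier approximations, uniformly in `θ` and jointly in the number `J` of terms
and in `n`: the points at distance at least `δ` from `θ` contribute a uniformly small error as
`J → ∞`, the other points a bounded error, and their fraction is controlled by the modulus of
continuity of `G`. -/
theorem eventually_abs_dataMean_fourierLE_sub_le {X : ℕ → Multiset (Set.Ioo (0 : ℝ) 1)}
    {G : ℝ → ℝ} (hG : Continuous G) (h : TendstoLocallyUniformly (fun n => empCDF (X n)) G atTop)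
    {ε : ℝ} (hε : 0 < ε) :
    ∀ᶠ p : ℕ × ℕ in atTop, ∀ θ ∈ Set.Icc (-1 : ℝ) 2,
      |dataMean (X p.2) (fun t => fourierLE p.1 t θ) - G θ| ≤ ε := by
  obtain ⟨C, hC0, hC⟩ := exists_abs_fourierLE_sub_indicator_le
  -- the error terms below add up to `(2 + 3 * C) * η`
  set η := ε / (2 + 3 * C) with hη
  have hη0 : 0 < η := by positivity
  have hηε : 2 * η + C * (3 * η) = ε := by
    rw [hη]
    field_simp
  have hunif := (isCompact_Icc (a := (-2 : ℝ)) (b := 3)).uniformContinuousOn_of_continuous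
    hG.continuousOn
  obtain ⟨δ', hδ', hmod⟩ := Metric.uniformContinuousOn_iff.1 hunif η hη0
  set δ := min (δ' / 4) 1
  have hδ : 0 < δ := lt_min (by positivity) one_pos
  have hδ1 : δ ≤ 1 := min_le_right _ _
  have hδ4 : δ ≤ δ' / 4 := min_le_left _ _
  have hcdf := Metric.tendstoUniformlyOn_iff.1
    ((tendstoLocallyUniformlyOn_iff_tendstoUniformlyOn_of_compact
      (isCompact_Icc (a := (-2 : ℝ)) (b := 3))).1 h.tendstoLocallyUniformlyOn) η hη0
  rw [← prod_atTop_atTop_eq]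
  filter_upwards [(eventually_abs_fourierLE_sub_indicator_le hδ hη0).prod_mk hcdf]
    with p ⟨hp1, hp2⟩ θ hθ
  have hpt : ∀ t ∈ Set.Ioo (0 : ℝ) 1,
      |fourierLE p.1 t θ - (Set.Iic θ).indicator (fun _ => (1 : ℝ)) t| ≤
        η + C * ((Set.Iic (θ + δ)).indicator (fun _ => (1 : ℝ)) t -
          (Set.Iic (θ - δ)).indicator (fun _ => (1 : ℝ)) t) := by
    intro t ht
    have h2 : |t - θ| ≤ 2 := by
      rw [abs_le]
      constructor <;> linarith [ht.1, ht.2, hθ.1, hθ.2]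
    by_cases hfar : δ ≤ |t - θ|
    · refine (hp1 t θ hfar h2).trans (le_add_of_nonneg_right (mul_nonneg hC0 (sub_nonneg.2 ?_)))
      exact Set.indicator_le_indicator_of_subset (Set.Iic_subset_Iic.2 (by linarith))
        (fun _ => zero_le_one) t
    · rw [not_le, abs_lt] at hfar
      rw [Set.indicator_of_mem (s := Set.Iic (θ + δ)) (Set.mem_Iic.2 (by linarith)),
        Set.indicator_of_notMem (s := Set.Iic (θ - δ)) (by rw [Set.mem_Iic]; linarith)]
      linarith [hC p.1 t θ h2]
  have hmean := abs_dataMean_sub_le (X p.2) hpt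
  rw [dataMean_add, dataMean_const_mul, dataMean_sub] at hmean
  have hconst := dataMean_const_le (X p.2) hη0.le
  change |_ - empCDF (X p.2) θ| ≤
    _ + C * (empCDF (X p.2) (θ + δ) - empCDF (X p.2) (θ - δ)) at hmean
  have hr := hp2 (θ + δ) ⟨by linarith [hθ.1], by linarith [hθ.2]⟩
  have hl := hp2 (θ - δ) ⟨by linarith [hθ.1], by linarith [hθ.2]⟩
  have hm := hp2 θ ⟨by linarith [hθ.1], by linarith [hθ.2]⟩
  have hw := hmod (θ + δ) ⟨by linarith [hθ.1], by linarith [hθ.2]⟩ (θ - δ)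
    ⟨by linarith [hθ.1], by linarith [hθ.2]⟩
    (by rw [Real.dist_eq, abs_lt]; constructor <;> linarith)
  rw [Real.dist_eq, abs_lt] at hr hl hm hw
  have hloc : C * (empCDF (X p.2) (θ + δ) - empCDF (X p.2) (θ - δ)) ≤ C * (3 * η) :=
    mul_le_mul_of_nonneg_left (by linarith) hC0
  rw [abs_le] at hmean ⊢
  constructor <;> linarith

/-! ### Windows of a continuous distribution function -/

/-- `G` has the properties of the distribution function of a law on `(0,1)` with an almost
everywhere positive density that the bandwidths depend on. -/
structure IsUnitCDF (G : ℝ → ℝ) : Prop where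
  continuous : Continuous G
  monotone : Monotone G
  strictMonoOn : StrictMonoOn G (Set.Icc 0 1)
  eq_zero : ∀ t ≤ 0, G t = 0
  eq_one : ∀ t, 1 ≤ t → G t = 1

namespace IsUnitCDF

variable {G : ℝ → ℝ} {α x : ℝ}

theorem exists_sub_eq (hG : IsUnitCDF G) (hα : α ∈ Set.Ioo (0 : ℝ) 1)
    (hx : x ∈ Set.Ioo (0 : ℝ) 1) : ∃ h ∈ Set.Ioo (0 : ℝ) 1, G (x + h) - G (x - h) = α := by
  have hc : Continuous fun h => G (x + h) - G (x - h) :=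
    (hG.continuous.comp (by fun_prop)).sub (hG.continuous.comp (by fun_prop))
  have := intermediate_value_Ioo zero_le_one hc.continuousOn
  refine this ⟨by simpa using hα.1, ?_⟩
  rw [hG.eq_one _ (by linarith [hx.1]), hG.eq_zero _ (by linarith [hx.2])]
  linarith [hα.2]

theorem sub_le_sub (hG : IsUnitCDF G) {a b : ℝ} (h : a ≤ b) :
    G (x + a) - G (x - a) ≤ G (x + b) - G (x - b) :=
  _root_.sub_le_sub (hG.monotone (by linarith)) (hG.monotone (by linarith))

/-- The mass of a window increases strictly with the bandwidth until it reaches `1`, since one of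
the ends of the smaller window lies inside `(0,1)`. -/
theorem sub_lt_sub (hG : IsUnitCDF G) (hx : x ∈ Set.Ioo (0 : ℝ) 1) {a b : ℝ} (ha : 0 ≤ a)
    (hab : a < b) (h1 : G (x + a) - G (x - a) < 1) :
    G (x + a) - G (x - a) < G (x + b) - G (x - b) := by
  by_cases hr : x + a < 1
  · have e1 : G (x + a) < G (min (x + b) 1) := hG.strictMonoOn
      ⟨by linarith [hx.1], hr.le⟩ ⟨le_min (by linarith [hx.1]) zero_le_one, min_le_right _ _⟩
      (lt_min (by linarith) hr)
    have e2 := hG.monotone (min_le_left (x + b) 1)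
    have e3 := hG.monotone (by linarith : x - b ≤ x - a)
    linarith
  · have hl : 0 < x - a := by
      by_contra hl
      rw [hG.eq_one _ (not_lt.1 hr), hG.eq_zero _ (not_lt.1 hl)] at h1
      linarith
    have e1 : G (max (x - b) 0) < G (x - a) := hG.strictMonoOn
      ⟨le_max_right _ _, max_le (by linarith [hx.2]) zero_le_one⟩ ⟨hl.le, by linarith [hx.2]⟩
      (max_lt (by linarith) hl)
    have e2 := hG.monotone (le_max_left (x - b) 0)
    have e3 := hG.monotone (by linarith : x + a ≤ x + b)
    linarith

variable {l : ℝ}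

theorem sub_lt_of_lt (hG : IsUnitCDF G) (hα : α < 1) (hx : x ∈ Set.Ioo (0 : ℝ) 1) (hl : 0 < l)
    (hlα : G (x + l) - G (x - l) = α) {a : ℝ} (ha : a < l) : G (x + a) - G (x - a) < α := by
  have h1 : max a 0 < l := max_lt ha hl
  have h2 : G (x + max a 0) - G (x - max a 0) < 1 := (hG.sub_le_sub h1.le).trans_lt (hlα ▸ hα)
  exact (hG.sub_le_sub (le_max_left a 0)).trans_lt
    ((hG.sub_lt_sub hx (le_max_right a 0) h1 h2).trans_eq hlα)

theorem lt_sub_of_lt (hG : IsUnitCDF G) (hα : α < 1) (hx : x ∈ Set.Ioo (0 : ℝ) 1) (hl : 0 < l)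
    (hlα : G (x + l) - G (x - l) = α) {b : ℝ} (hb : l < b) : α < G (x + b) - G (x - b) :=
  hlα ▸ hG.sub_lt_sub hx hl.le hb (hlα ▸ hα)

/-! ### Consistency of the bandwidths along a convergent sequence of data sets -/

variable {X : ℕ → Multiset (Set.Ioo (0 : ℝ) 1)}

theorem tendsto_exactBandwidths (hG : IsUnitCDF G) (hα : α < 1) (hx : x ∈ Set.Ioo (0 : ℝ) 1)
    (hl : 0 < l) (hlα : G (x + l) - G (x - l) = α)
    (hX : TendstoLocallyUniformly (fun n => empCDF (X n)) G atTop) {u : ℕ → ℝ}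
    (hu : ∀ n, 1 ≤ n → u n ∈ exactBandwidths α x (X n)) : Tendsto u atTop (𝓝 l) := by
  have hlim : ∀ a, Tendsto (fun n => empCDF (X n) (x + a) - empCDF (X n) (x - a)) atTop
      (𝓝 (G (x + a) - G (x - a))) := fun a =>
    ((tendstoLocallyUniformlyOn_univ.2 hX).tendsto_at (Set.mem_univ (x + a))).sub
      ((tendstoLocallyUniformlyOn_univ.2 hX).tendsto_at (Set.mem_univ (x - a)))
  refine tendsto_order.2 ⟨fun a ha => ?_, fun b hb => ?_⟩
  · obtain ⟨a', haa', ha'⟩ := exists_between ha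
    filter_upwards [(hlim a').eventually (gt_mem_nhds (hG.sub_lt_of_lt hα hx hl hlα ha')),
      eventually_ge_atTop 1] with n hn hn1
    obtain ⟨hmem, -, hle⟩ := hu n hn1
    by_contra hlt
    linarith [empirical_le (x := x) hmem.1.le (by linarith : u n < a') (X n)]
  · obtain ⟨b', hb', hbb'⟩ := exists_between hb
    filter_upwards [(hlim b').eventually (lt_mem_nhds (hG.lt_sub_of_lt hα hx hl hlα hb')),
      eventually_ge_atTop 1] with n hn hn1
    obtain ⟨-, hle, -⟩ := hu n hn1
    by_contra hlt
    linarith [le_empiricalLeft (x := x) (by linarith : b' < u n) (X n)]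

theorem eventually_abs_fourierEmpirical_sub_le (hG : IsUnitCDF G) (hx : x ∈ Set.Ioo (0 : ℝ) 1)
    (hX : TendstoLocallyUniformly (fun n => empCDF (X n)) G atTop) {ε : ℝ} (hε : 0 < ε) :
    ∀ᶠ p : ℕ × ℕ in atTop, ∀ h ∈ Set.Icc (0 : ℝ) 1,
      |fourierEmpirical p.1 x (X p.2) h - (G (x + h) - G (x - h))| ≤ ε := by
  filter_upwards [eventually_abs_dataMean_fourierLE_sub_le hG.continuous hX (half_pos hε)]
    with p hp h hh
  have h1 := hp (x + h) ⟨by linarith [hx.1, hh.1], by linarith [hx.2, hh.2]⟩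
  have h2 := hp (x - h) ⟨by linarith [hx.1, hh.2], by linarith [hx.2, hh.1]⟩
  rw [fourierEmpirical_eq_dataMean]
  rw [abs_le] at h1 h2 ⊢
  constructor <;> linarith

theorem eventually_fourierBandwidths_nonempty (hG : IsUnitCDF G) (hα : α ∈ Set.Ioo (0 : ℝ) 1)
    (hx : x ∈ Set.Ioo (0 : ℝ) 1) (hX : TendstoLocallyUniformly (fun n => empCDF (X n)) G atTop) :
    ∀ᶠ p : ℕ × ℕ in atTop, (fourierBandwidths p.1 α x (X p.2)).Nonempty := by
  obtain ⟨l, hl, hlα⟩ := hG.exists_sub_eq hα hx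
  obtain ⟨b, hlb, hb⟩ := exists_between hl.2
  have hb0 : 0 < b := hl.1.trans hlb
  have hgap := hG.lt_sub_of_lt hα.2 hx hl.1 hlα hlb
  filter_upwards [hG.eventually_abs_fourierEmpirical_sub_le hx hX (sub_pos.2 hgap)] with p hp
  have hpb := (abs_le.1 (hp b ⟨hb0.le, hb.le⟩)).1
  have h0 : fourierEmpirical p.1 x (X p.2) 0 = 0 := by simp [fourierEmpirical_eq_dataMean]
  obtain ⟨h, hh, hhα⟩ := intermediate_value_Icc hb0.le
    (continuous_fourierEmpirical p.1 x (X p.2)).continuousOn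
    ⟨h0.trans_le hα.1.le, (by linarith : α ≤ fourierEmpirical p.1 x (X p.2) b)⟩
  refine ⟨h, ⟨hh.1.lt_of_ne ?_, hh.2.trans_lt hb⟩, hhα⟩
  rintro rfl
  linarith [hα.1]

/-- All solutions of the approximate bandwidth equation are close to the population bandwidth once
`J` and `n` are large. -/
theorem eventually_abs_fourierBandwidths_sub_le (hG : IsUnitCDF G) (hα : α < 1)
    (hx : x ∈ Set.Ioo (0 : ℝ) 1) (hl : 0 < l) (hlα : G (x + l) - G (x - l) = α)
    (hX : TendstoLocallyUniformly (fun n => empCDF (X n)) G atTop) {ε : ℝ} (hε : 0 < ε) :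
    ∀ᶠ p : ℕ × ℕ in atTop, ∀ h ∈ fourierBandwidths p.1 α x (X p.2),
      h ∈ Set.Icc (l - ε) (l + ε) := by
  have h1 := hG.sub_lt_of_lt hα hx hl hlα (sub_lt_self l hε)
  have h2 := hG.lt_sub_of_lt hα hx hl hlα (lt_add_of_pos_right l hε)
  obtain ⟨η, hη, hη'⟩ := exists_between (lt_min (sub_pos.2 h1) (sub_pos.2 h2))
  filter_upwards [hG.eventually_abs_fourierEmpirical_sub_le hx hX hη] with p hp h hh
  obtain ⟨hmem, hhα⟩ := hh
  have hb := abs_le.1 (hhα ▸ hp h ⟨hmem.1.le, hmem.2.le⟩)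
  have e1 := hη'.trans_le (min_le_left _ _)
  have e2 := hη'.trans_le (min_le_right _ _)
  constructor
  · by_contra hlt
    linarith [hG.sub_le_sub (x := x) (by linarith : h ≤ l - ε), hb.1, hb.2]
  · by_contra hlt
    linarith [hG.sub_le_sub (x := x) (by linarith : l + ε ≤ h), hb.1, hb.2]

end IsUnitCDF

theorem limsup_mem_Icc_and_liminf_mem_Icc {u : ℕ → ℝ} {a b : ℝ}
    (h : ∀ᶠ n in atTop, u n ∈ Set.Icc a b) :
    limsup u atTop ∈ Set.Icc a b ∧ liminf u atTop ∈ Set.Icc a b := by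
  have hle : ∀ᶠ n in atTop, u n ≤ b := h.mono fun n hn => hn.2
  have hge : ∀ᶠ n in atTop, a ≤ u n := h.mono fun n hn => hn.1
  have hB : IsBoundedUnder (· ≤ ·) atTop u := ⟨b, hle⟩
  have hB' : IsBoundedUnder (· ≥ ·) atTop u := ⟨a, hge⟩
  have h1 : a ≤ liminf u atTop := le_liminf_of_le hB.isCoboundedUnder_ge hge
  have h2 : limsup u atTop ≤ b := limsup_le_of_le hB'.isCoboundedUnder_le hle
  have h3 : liminf u atTop ≤ limsup u atTop := liminf_le_limsup hB hB'
  exact ⟨⟨h1.trans h3, h2⟩, h1, h3.trans h2⟩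

theorem IsUnitCDF.tendsto_limsup_and_liminf {G : ℝ → ℝ} {α x l : ℝ} (hG : IsUnitCDF G)
    (hα : α ∈ Set.Ioo (0 : ℝ) 1) (hx : x ∈ Set.Ioo (0 : ℝ) 1) (hl : 0 < l)
    (hlα : G (x + l) - G (x - l) = α) {X : ℕ → Multiset (Set.Ioo (0 : ℝ) 1)}
    (hX : TendstoLocallyUniformly (fun n => empCDF (X n)) G atTop) {u : ℕ → ℕ → ℝ}
    (hu : ∀ J n, (fourierBandwidths J α x (X n)).Nonempty → u J n ∈ fourierBandwidths J α x (X n)) :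
    Tendsto (fun J => limsup (fun n => u J n) atTop) atTop (𝓝 l) ∧
      Tendsto (fun J => liminf (fun n => u J n) atTop) atTop (𝓝 l) := by
  have key : ∀ ε > 0, ∀ᶠ J in atTop,
      limsup (fun n => u J n) atTop ∈ Set.Icc (l - ε) (l + ε) ∧
        liminf (fun n => u J n) atTop ∈ Set.Icc (l - ε) (l + ε) := by
    intro ε hε
    have := (hG.eventually_fourierBandwidths_nonempty hα hx hX).and
      (hG.eventually_abs_fourierBandwidths_sub_le hα.2 hx hl hlα hX hε)
    filter_upwards [eventually_atTop_curry this] with J hJ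
    exact limsup_mem_Icc_and_liminf_mem_Icc (hJ.mono fun n hn => hn.2 _ (hu J n hn.1))
  constructor <;> refine (nhds_basis_Icc_pos l).tendsto_right_iff.2 fun ε hε => ?_
  · exact (key ε hε).mono fun J hJ => hJ.1
  · exact (key ε hε).mono fun J hJ => hJ.2

/-! ### Existence of the exact bandwidth -/

/-- If no observation equals `x`, the least distance `h` of an observation from `x` such that
`α ≤ empirical x X h` is an exact bandwidth. -/
theorem exactBandwidths_nonempty {α x : ℝ} (hα : α ∈ Set.Ioo (0 : ℝ) 1)
    (hx : x ∈ Set.Ioo (0 : ℝ) 1) {X : Multiset (Set.Ioo (0 : ℝ) 1)} (hX : X ≠ 0)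
    (hne : ∀ y ∈ X, (y : ℝ) ≠ x) : (exactBandwidths α x X).Nonempty := by
  classical
  have hcard : (0 : ℝ) < X.card := by exact_mod_cast Multiset.card_pos.2 hX
  let D : Finset ℝ := (X.map fun y : Set.Ioo (0 : ℝ) 1 => |(y : ℝ) - x|).toFinset
  have hmemD : ∀ y ∈ X, |(y : ℝ) - x| ∈ D := fun y hy =>
    Multiset.mem_toFinset.2 (Multiset.mem_map_of_mem _ hy)
  have hD : ∀ d ∈ D, d ∈ Set.Ioo (0 : ℝ) 1 := by
    intro d hd
    obtain ⟨y, hy, rfl⟩ := Multiset.mem_map.1 (Multiset.mem_toFinset.1 hd)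
    refine ⟨abs_pos.2 (sub_ne_zero.2 (hne y hy)), abs_lt.2 ⟨?_, ?_⟩⟩ <;>
      linarith [y.2.1, y.2.2, hx.1, hx.2]
  -- the fraction of data at distance less than `h` is counted at the largest such distance
  have hleft : ∀ h, 0 < empiricalLeft x X h →
      ∃ d ∈ D, d < h ∧ empiricalLeft x X h ≤ empirical x X d := by
    intro h hpos
    have hne' : (D.filter (· < h)).Nonempty := by
      by_contra hempty
      rw [Finset.not_nonempty_iff_eq_empty, Finset.filter_eq_empty_iff] at hempty
      refine hpos.ne' ?_
      rw [empiricalLeft_eq, Multiset.sum_eq_zero, zero_div]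
      intro r hr
      obtain ⟨y, hy, rfl⟩ := Multiset.mem_map.1 hr
      refine Set.indicator_of_notMem (fun hmem => hempty (hmemD y hy) ?_) _
      exact abs_lt.2 ⟨by linarith [hmem.1], by linarith [hmem.2]⟩
    have hmax := Finset.mem_filter.1 ((D.filter (· < h)).max'_mem hne')
    refine ⟨(D.filter (· < h)).max' hne', hmax.1, hmax.2, ?_⟩
    rw [empiricalLeft_eq, empirical_eq]
    gcongr ?_ / _
    refine Multiset.sum_map_le_sum_map _ _ fun y hy => ?_
    by_cases hmem : (y : ℝ) ∈ Set.Ioo (x - h) (x + h)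
    · have hle := Finset.le_max' (D.filter (· < h)) |(y : ℝ) - x| (Finset.mem_filter.2
        ⟨hmemD y hy, abs_lt.2 ⟨by linarith [hmem.1], by linarith [hmem.2]⟩⟩)
      rw [abs_le] at hle
      rw [Set.indicator_of_mem hmem, Set.indicator_of_mem]
      exact ⟨by linarith [hle.1], by linarith [hle.2]⟩
    · rw [Set.indicator_of_notMem hmem]
      exact Set.indicator_nonneg (fun _ _ => zero_le_one) _
  have hS : (D.filter fun d => α ≤ empirical x X d).Nonempty := by
    have hone : empiricalLeft x X 1 = 1 := by
      have hall : ∀ y : Set.Ioo (0 : ℝ) 1, (y : ℝ) ∈ Set.Ioo (x - 1) (x + 1) := fun y =>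
        ⟨by linarith [y.2.1, hx.2], by linarith [y.2.2, hx.1]⟩
      simp [empiricalLeft_eq, Set.indicator_of_mem (hall _), hcard.ne']
    obtain ⟨d, hd, -, hle⟩ := hleft 1 (by rw [hone]; exact one_pos)
    exact ⟨d, Finset.mem_filter.2 ⟨hd, by linarith [hα.2]⟩⟩
  have hmin := Finset.mem_filter.1 (Finset.min'_mem _ hS)
  refine ⟨_, hD _ hmin.1, ?_, hmin.2⟩
  by_contra! hlt
  obtain ⟨d, hd, hdlt, hle⟩ := hleft _ (hα.1.trans hlt)
  have hd' : d ∈ D.filter fun d => α ≤ empirical x X d :=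
    Finset.mem_filter.2 ⟨hd, hlt.le.trans hle⟩
  exact absurd (Finset.min'_le _ d hd') hdlt.not_ge

/-! ### The law of an observation -/

theorem IsPositiveDensity.nullSingletonClass {μ : Measure ℝ} {f : ℝ → ℝ}
    (hf : IsPositiveDensity μ f) : NullSingletonClass μ := by
  refine ⟨fun t => ?_⟩
  rw [hf.eq_withDensity]
  exact withDensity_absolutelyContinuous _ _ (measure_singleton t)

theorem continuous_cdf (μ : Measure ℝ) [IsProbabilityMeasure μ] [NullSingletonClass μ] :
    Continuous (cdf μ) := by
  refine continuous_iff_continuousAt.2 fun t => ?_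
  rw [(cdf μ).mono.continuousAt_iff_leftLim_eq_rightLim, (cdf μ).rightLim_eq]
  have h := (cdf μ).measure_singleton t
  rw [measure_cdf, measure_singleton, eq_comm, ENNReal.ofReal_eq_zero] at h
  exact le_antisymm ((cdf μ).mono.leftLim_le le_rfl) (by linarith)

theorem IsPositiveDensity.isUnitCDF {μ : Measure ℝ} [IsProbabilityMeasure μ] {f : ℝ → ℝ}
    (hf : IsPositiveDensity μ f) (hμ : ∀ᵐ t ∂μ, t ∈ Set.Ioo (0 : ℝ) 1) : IsUnitCDF (cdf μ) := by
  have := hf.nullSingletonClass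
  refine ⟨continuous_cdf μ, (cdf μ).mono, fun a ha b hb hab => ?_, fun t ht => ?_, fun t ht => ?_⟩
  · by_contra hle
    have h0 : μ (Set.Ioc a b) = 0 := by
      rw [← measure_cdf μ, StieltjesFunction.measure_Ioc, ENNReal.ofReal_eq_zero]
      linarith
    rw [hf.eq_withDensity, withDensity_apply_eq_zero' hf.measurable.ennreal_ofReal.aemeasurable]
      at h0
    have h1 : ∀ᵐ t, t ∉ Set.Ioo a b := by
      filter_upwards [measure_eq_zero_iff_ae_notMem.1 h0,
        (ae_restrict_iff' measurableSet_Ioo).1 hf.ae_pos] with t ht hpos hmem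
      refine ht ⟨?_, hmem.1, hmem.2.le⟩
      simpa using hpos ⟨ha.1.trans_lt hmem.1, hmem.2.trans_le hb.2⟩
    have h2 := measure_eq_zero_iff_ae_notMem.2 h1
    rw [Real.volume_Ioo, ENNReal.ofReal_eq_zero] at h2
    linarith
  · rw [cdf_eq_real, measureReal_eq_zero_iff, measure_eq_zero_iff_ae_notMem]
    filter_upwards [hμ] with s hs hst
    linarith [hs.1, Set.mem_Iic.1 hst]
  · rw [cdf_eq_real, measureReal_def, (prob_compl_eq_zero_iff measurableSet_Iic).1,
      ENNReal.toReal_one]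
    rw [measure_eq_zero_iff_ae_notMem]
    filter_upwards [hμ] with s hs hst
    exact hst (hs.2.le.trans ht)

/-! ### The sampling model -/

theorem empCDF_sample {Ω : Type*} (ξ : ℕ → Ω → Set.Ioo (0 : ℝ) 1) (n : ℕ) (ω : Ω) (t : ℝ) :
    empCDF (sample ξ n ω) t =
      (∑ i ∈ Finset.range n, (Set.Iic t).indicator (fun _ => (1 : ℝ)) (ξ i ω : ℝ)) / n := by
  simp only [empCDF, dataMean, sample, Multiset.map_map, Multiset.card_map, Multiset.card_range]
  rfl

variable {Ω : Type*} [MeasurableSpace Ω] {P : Measure Ω} [IsProbabilityMeasure P]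
  {ξ : ℕ → Ω → Set.Ioo (0 : ℝ) 1}

theorem ae_tendsto_empCDF_sample (hmeas : ∀ i, Measurable (ξ i)) (hindep : iIndepFun ξ P)
    (hident : ∀ i, IdentDistrib (ξ i) (ξ 0) P P) (t : ℝ) :
    ∀ᵐ ω ∂P, Tendsto (fun n => empCDF (sample ξ n ω) t) atTop
      (𝓝 (cdf (P.map fun ω => (ξ 0 ω : ℝ)) t)) := by
  have hg : Measurable fun y : Set.Ioo (0 : ℝ) 1 =>
      (Set.Iic t).indicator (fun _ => (1 : ℝ)) (y : ℝ) :=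
    (measurable_const.indicator measurableSet_Iic).comp measurable_subtype_coe
  have hξ : Measurable fun ω => (ξ 0 ω : ℝ) := measurable_subtype_coe.comp (hmeas 0)
  have := Measure.isProbabilityMeasure_map (μ := P) hξ.aemeasurable
  have hint : Integrable (fun ω => (Set.Iic t).indicator (fun _ => (1 : ℝ)) (ξ 0 ω : ℝ)) P := by
    refine Integrable.of_bound (hg.comp (hmeas 0)).aestronglyMeasurable 1 (ae_of_all _ fun ω => ?_)
    exact (norm_indicator_le_norm_self _ _).trans norm_one.le
  have hexp : ∫ ω, (Set.Iic t).indicator (fun _ => (1 : ℝ)) (ξ 0 ω : ℝ) ∂P =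
      cdf (P.map fun ω => (ξ 0 ω : ℝ)) t := by
    rw [cdf_eq_real, ← integral_map hξ.aemeasurable
      (measurable_const.indicator measurableSet_Iic).aestronglyMeasurable]
    exact integral_indicator_one measurableSet_Iic
  have h := strong_law_ae_real
    (fun i ω => (Set.Iic t).indicator (fun _ => (1 : ℝ)) (ξ i ω : ℝ)) hint
    (fun i j hij => (hindep.indepFun hij).comp hg hg) (fun i => (hident i).comp hg)
  rw [hexp] at h
  simpa only [empCDF_sample] using h

/-- Almost surely the empirical distribution functions converge locally uniformly to the
distribution function of a law without atoms. -/
theorem ae_tendstoLocallyUniformly_empCDF_sample (hmeas : ∀ i, Measurable (ξ i))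
    (hindep : iIndepFun ξ P) (hident : ∀ i, IdentDistrib (ξ i) (ξ 0) P P)
    (hc : Continuous (cdf (P.map fun ω => (ξ 0 ω : ℝ)))) :
    ∀ᵐ ω ∂P, TendstoLocallyUniformly (fun n => empCDF (sample ξ n ω))
      (cdf (P.map fun ω => (ξ 0 ω : ℝ))) atTop := by
  filter_upwards [ae_all_iff.2 fun q : ℚ => ae_tendsto_empCDF_sample hmeas hindep hident q]
    with ω hω
  exact tendstoLocallyUniformly_of_monotone (fun n => empCDF_monotone _) hc hω

theorem ae_forall_ne {P : Measure Ω} (hmeas : ∀ i, Measurable (ξ i))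
    (hident : ∀ i, IdentDistrib (ξ i) (ξ 0) P P)
    (hna : NullSingletonClass (P.map fun ω => (ξ 0 ω : ℝ)))
    (x : ℝ) : ∀ᵐ ω ∂P, ∀ i, (ξ i ω : ℝ) ≠ x := by
  refine ae_all_iff.2 fun i => ?_
  have h1 := (hident i).measure_mem_eq
    (measurable_subtype_coe (p := (· ∈ Set.Ioo (0 : ℝ) 1)) (measurableSet_singleton x))
  have h2 : (P.map fun ω => (ξ 0 ω : ℝ)) {x} = 0 := measure_singleton x
  have hξ : Measurable fun ω => (ξ 0 ω : ℝ) := measurable_subtype_coe.comp (hmeas 0)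
  rw [Measure.map_apply hξ (measurableSet_singleton x)] at h2
  exact measure_eq_zero_iff_ae_notMem.1 (h1.trans h2)

end LocalRegression

theorem mainTheorem2 {Ω : Type*} [MeasurableSpace Ω] (P : Measure Ω) [IsProbabilityMeasure P]
    (ξ : ℕ → Ω → Set.Ioo (0 : ℝ) 1)
    (hmeas : ∀ i, Measurable (ξ i))
    (hindep : iIndepFun ξ P)
    (hident : ∀ i, IdentDistrib (ξ i) (ξ 0) P P)
    (f : ℝ → ℝ)
    (hf : IsPositiveDensity (P.map fun ω => (ξ 0 ω : ℝ)) f)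
    (α : ℝ) (hα : α ∈ Set.Ioo (0 : ℝ) 1) (x : ℝ) (hx : x ∈ Set.Ioo (0 : ℝ) 1) :
    -- almost surely the exact bandwidth exists for every nonempty sample
    (∀ᵐ ω ∂P, ∀ n : ℕ, 1 ≤ n → (exactBandwidths α x (sample ξ n ω)).Nonempty) ∧
    -- every solution of the approximate equation is a WEP statistic; if it is obtained from the
    -- function `h ↦ fourierEmpirical J x X h`, it is a function of the SEP statistic `trigSums J`
    (∀ J : ℕ, IsSEP (trigSums J) ∧
      ∀ (D : Set (Multiset (Set.Ioo (0 : ℝ) 1))),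
        D = {X | X ≠ 0 ∧ (fourierBandwidths J α x X).Nonempty} →
        ∀ T : Multiset (Set.Ioo (0 : ℝ) 1) → ℝ,
          (∀ X ∈ D, T X ∈ fourierBandwidths J α x X) →
          IsWEPOn D T ∧
          ((∀ X ∈ D, ∀ X' ∈ D,
              Set.EqOn (fourierEmpirical J x X) (fourierEmpirical J x X') (Set.Ioo (0 : ℝ) 1) →
                T X = T X') →
            ∃ G : (Fin (2 * J + 1) → ℝ) → ℝ, ∀ X ∈ D, T X = G (trigSums J X))) ∧
    -- existence and consistency of the approximate bandwidths
    (TendstoUniformlyOn (fun (J : ℕ) (h : ℝ) => fourierDensity (P.map fun ω => (ξ 0 ω : ℝ)) J x h)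
        (fun h => f (x - h) + f (x + h)) atTop (Set.Ioo (0 : ℝ) 1) →
      (∀ᵐ ω ∂P, ∀ᶠ p : ℕ × ℕ in atTop,
        (fourierBandwidths p.1 α x (sample ξ p.2 ω)).Nonempty) ∧
      ∃ hlim ∈ Set.Ioo (0 : ℝ) 1,
        P.real {ω | (ξ 0 ω : ℝ) ∈ Set.Icc (x - hlim) (x + hlim)} = α ∧
        ∀ᵐ ω ∂P,
          (∀ hexact : ℕ → ℝ,
            (∀ n, 1 ≤ n → hexact n ∈ exactBandwidths α x (sample ξ n ω)) →
              Tendsto hexact atTop (𝓝 hlim)) ∧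
          ∀ happrox : ℕ → ℕ → ℝ,
            (∀ J n, (fourierBandwidths J α x (sample ξ n ω)).Nonempty →
              happrox J n ∈ fourierBandwidths J α x (sample ξ n ω)) →
            Tendsto (fun J => limsup (fun n => happrox J n) atTop) atTop (𝓝 hlim) ∧
            Tendsto (fun J => liminf (fun n => happrox J n) atTop) atTop (𝓝 hlim)) := by
  have hξ : Measurable fun ω => (ξ 0 ω : ℝ) := measurable_subtype_coe.comp (hmeas 0)
  have hprob := Measure.isProbabilityMeasure_map (μ := P) hξ.aemeasurable
  have hna := hf.nullSingletonClass
  have hG : IsUnitCDF (cdf (P.map fun ω => (ξ 0 ω : ℝ))) := hf.isUnitCDF <|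
    (ae_map_iff hξ.aemeasurable measurableSet_Ioo).2 (ae_of_all _ fun ω => (ξ 0 ω).2)
  have hconv := ae_tendstoLocallyUniformly_empCDF_sample hmeas hindep hident hG.continuous
  refine ⟨?_, fun J => ⟨isSEP_trigSums J, fun D _ T _ => ⟨isWEPOn_of_Ioo D T,
    exists_eq_comp_trigSums⟩⟩, fun _ => ⟨?_, ?_⟩⟩
  · filter_upwards [ae_forall_ne hmeas hident hna x] with ω hω n hn
    refine exactBandwidths_nonempty hα hx ?_ fun y hy => ?_
    · rw [← Multiset.card_pos, sample, Multiset.card_map, Multiset.card_range]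
      exact hn
    · obtain ⟨i, -, rfl⟩ := Multiset.mem_map.1 hy
      exact hω i
  · filter_upwards [hconv] with ω hω
    exact hG.eventually_fourierBandwidths_nonempty (X := fun n => sample ξ n ω) hα hx hω
  · -- the population bandwidth solves `cdf (x + l) - cdf (x - l) = α`
    obtain ⟨l, hl, hlα⟩ := hG.exists_sub_eq hα hx
    refine ⟨l, hl, ?_, ?_⟩
    · have hmass : (P.map fun ω => (ξ 0 ω : ℝ)) (Set.Icc (x - l) (x + l)) = ENNReal.ofReal α := by
        rw [← hlα, ← StieltjesFunction.measure_Ioc, measure_cdf]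
        exact measure_congr Ioc_ae_eq_Icc.symm
      rw [Measure.map_apply hξ measurableSet_Icc] at hmass
      rw [measureReal_def]
      exact (congrArg ENNReal.toReal hmass).trans (ENNReal.toReal_ofReal hα.1.le)
    · filter_upwards [hconv] with ω hω
      exact ⟨fun u hu =>
          hG.tendsto_exactBandwidths (X := fun n => sample ξ n ω) hα.2 hx hl.1 hlα hω hu,
        fun u hu =>
          hG.tendsto_limsup_and_liminf (X := fun n => sample ξ n ω) hα hx hl.1 hlα hω hu⟩
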